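/- **Setting.** Let $\mathcal K_1$ be Kleene's first model ($a\cdot b=\varphi_a(b)$ on $\mathbb N$). Let $\Phi=\mathbf 2^{\mathbb N}$ be the set of predicates on $\mathbb N$, and for $\phi,\psi\in\Phi$, $e\in\mathbb N$ write $\phi\xrightarrow{e}\psi$ if for every $c$ with $\phi(c)$ the value $\varphi_e(c)$ is defined and satisfies $\psi$. With all $e\in\mathbb N$ as evidences this is an evidenced frame $\mathcal{EF}_{\mathcal K_1}$: $\top$ is the constantly true predicate, $(\phi\wedge\psi)(\langle a,b\rangle)$ iff $\phi(a)$ and $\psi(b)$, and, for $\Psi\subseteq\Phi$, $(\phi\supset\Psi)(e)$ iff $\phi\xrightarrow{e}\psi$ for all $\psi\in\Psi$. Put $\phi\supset\psi:=\phi\supset\{\psi\}$, let $\phi\leftrightsquigarrow\psi$ be the conjunction of the two implications, $\prod\Psi:=\top\supset\Psi$, and $\coprod\Psi:=\prod\{\prod\{\psi\supset\phi\mid\psi\in\Psi\}\supset\phi\mid\phi\in\Phi\}$; for a family $\phi\colon X\to\Phi$ write $\prod_x\phi(x)$ and $\coprod_x\phi(x)$ for $\prod$ and $\coprod$ of its set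 of values. A proposition $\phi$ is *evidenceable* if $\top\xrightarrow{e}\phi$ for some $e$. The effective topos $\mathrm{EFT}(\mathcal{EF}_{\mathcal K_1})$ has as objects the pairs $(X,\sim)$ of a set $X$ and $\sim\colon X\times X\to\Phi$ with $\prod_{x,y}(x\sim y\supset y\sim x)$ and $\prod_{x,y,z}(x\sim y\wedge y\sim z\supset x\sim z)$ evidenceable; write $\mathsf{ex}(x):=x\sim x$, and $\mathsf{ex}(x,y):=\mathsf{ex}(x)\wedge\mathsf{ex}(y)$, etc. A functional predicate $F\colon(X,\sim)\to(Y,\sim)$ is a function $F\colon X\times Y\to\Phi$ such that $\prod_{x,x',y,y'}(x\sim x'\wedge y\sim y'\wedge F(x,y)\supset F(x',y'))$, $\prod_{x,y,y'}(\mathsf{ex}(x,y,y')\wedge F(x,y)\wedge F(x,y')\supset y\sim y')$ and $\prod_x(\mathsf{ex}(x)\supset\coprod_y(\mathsf{ex}(y)\wedge F(x,y)))$ are evidenceable. Morphisms are classes of functional predicates, where $F$ and $G$ are equivalent if $\prod_{x,y}(\mathsf{ex}(x,y)\supset(F(x,y)\leftrightsquigarrow G(x,y)))$ is evidenceable; $G\circ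 F$ is represented by $\coprod_y(\mathsf{ex}(y)\wedge F(x,y)\wedge G(y,z))$. A function $f\colon X\to Y$ such that $\prod_{x,x'}(x\sim x'\supset f(x)\sim f(x'))$ is evidenceable is called extensional, and it represents the morphism given by $(x,y)\mapsto f(x)\sim y$; identities are represented by identity functions. The terminal object is a singleton $\{*\}$ with $*\sim *$ equal to $\top$, and the subobject classifier is $(\Phi,\leftrightsquigarrow)$ with $\mathsf{true}$ represented by $*\mapsto\top$. A Lawvere–Tierney topology is a function $j\colon\Phi\to\Phi$ that is extensional from $(\Phi,\leftrightsquigarrow)$ to itself and for which $\prod_\phi(\phi\supset j\phi)$, $\prod_\phi(jj\phi\supset j\phi)$ and $\prod_{\phi,\psi}(j(\phi\wedge\psi)\leftrightsquigarrow j\phi\wedge j\psi)$ are evidenceable. A monomorphism $m\colon S\hookrightarrow X$ with classifying morphism $\chi_m$ is *$j$-dense* if its $j$-closure $\overline m\colon\overline S\hookrightarrow X$, the subobject classified by $j\circ\chi_m$, is an isomorphism. An object $A$ is *$j$-separated* (a *$j$-sheaf*) if for every $j$-dense monomorphism $m\colon S\hookrightarrow X$ the map $f\mapsto f\circ m$ from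 morphisms $X\to A$ to morphisms $S\to A$ is injective (bijective). **Theorem.** Let $j$ be a Lawvere–Tierney topology on $\mathrm{EFT}(\mathcal{EF}_{\mathcal K_1})$ and $(A,\sim_A)$ an object. (1) $A$ is $j$-separated if and only if $$\mathtt{sep}(A):=\prod_{a\in A}\prod_{b\in A}\bigl(\mathsf{ex}(a,b)\wedge j(a\sim_A b)\supset a\sim_A b\bigr)$$ is evidenceable. (2) $A$ is a $j$-sheaf if and only if it is $j$-separated and, for every $j$-dense monomorphism $m\colon S\hookrightarrow X$, every morphism $g\colon S\to A$, and all functional predicates $M$ and $G$ representing $m$ and $g$, the proposition $$\mathtt{dsc}(A):=\prod_{x\in X}\Bigl(\mathsf{ex}(x)\supset\coprod_{a\in A}\bigl(\mathsf{ex}(a)\wedge\prod_{b\in A}(\mathsf{ex}(b)\supset(\psi_x(b)\leftrightsquigarrow j(a\sim_A b)))\bigr)\Bigr)$$ is evidenceable, where $\psi_x(b):=j\bigl(\coprod_{s\in S}(\mathsf{ex}(s)\wedge M(s,x)\wedge G(s,b))\bigr)$. (If $m$ and $g$ are represented by functions, one may take $M(s,x)=(m(s)\sim x)$ and $G(s,b)=(g(s)\sim_A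 b)$.) -/

import Mathlib

open CategoryTheory

universe u v w w'

/-- An evidenced frame: propositions `Prp`, evidences `Evd`, the evidence relation
`rel φ e ψ`, and the constructs for reflexivity, transitivity, top,
conjunction and universal implication. -/
structure EvidencedFrame where
  Prp : Type u
  Evd : Type v
  rel : Prp → Evd → Prp → Prop
  eId : Evd
  rel_id : ∀ φ, rel φ eId φ
  eComp : Evd → Evd → Evd
  rel_comp : ∀ {φ₁ φ₂ φ₃ e₁ e₂}, rel φ₁ e₁ φ₂ → rel φ₂ e₂ φ₃ → rel φ₁ (eComp e₁ e₂) φ₃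
  top : Prp
  eTop : Evd
  rel_top : ∀ φ, rel φ eTop top
  and : Prp → Prp → Prp
  ePair : Evd → Evd → Evd
  eFst : Evd
  eSnd : Evd
  rel_pair : ∀ {φ ψ₁ ψ₂ e₁ e₂}, rel φ e₁ ψ₁ → rel φ e₂ ψ₂ → rel φ (ePair e₁ e₂) (and ψ₁ ψ₂)
  rel_fst : ∀ φ₁ φ₂, rel (and φ₁ φ₂) eFst φ₁
  rel_snd : ∀ φ₁ φ₂, rel (and φ₁ φ₂) eSnd φ₂
  uimp : Prp → Set Prp → Prp
  eLam : Evd → Evd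
  eEval : Evd
  rel_lam : ∀ {φ₁ φ₂ e} {Ψ : Set Prp},
    (∀ ψ ∈ Ψ, rel (and φ₁ φ₂) e ψ) → rel φ₁ (eLam e) (uimp φ₂ Ψ)
  rel_eval : ∀ (φ : Prp) (Ψ : Set Prp), ∀ ψ ∈ Ψ, rel (and (uimp φ Ψ) φ) eEval ψ

namespace EvidencedFrame

variable {EF : EvidencedFrame.{u, v}}

/-- A proposition is evidenceable when it is evidenced by some evidence from `⊤`. -/
def Evidenceable (φ : EF.Prp) : Prop := ∃ e, EF.rel EF.top e φ

/-- `φ ⊃ ψ`. -/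
def imp (φ ψ : EF.Prp) : EF.Prp := EF.uimp φ {ψ}

/-- `∏ Ψ` for a set `Ψ` of propositions. -/
def prod (Ψ : Set EF.Prp) : EF.Prp := EF.uimp EF.top Ψ

/-- `⊥`. -/
def bot : EF.Prp := prod Set.univ

/-- `∐ Ψ` for a set `Ψ` of propositions. -/
def coprod (Ψ : Set EF.Prp) : EF.Prp :=
  prod (Set.range fun φ : EF.Prp => imp (prod ((fun ψ => imp ψ φ) '' Ψ)) φ)

/-- `∏_{x ∈ X} φ x`. -/
def all {X : Type w} (φ : X → EF.Prp) : EF.Prp := prod (Set.range φ)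

/-- `∐_{x ∈ X} φ x`. -/
def some {X : Type w} (φ : X → EF.Prp) : EF.Prp := coprod (Set.range φ)

end EvidencedFrame

infixr:65 " ⊓ₑ " => EvidencedFrame.and _
infixr:60 " ⊃ₑ " => EvidencedFrame.imp

namespace EvidencedFrame

variable {EF : EvidencedFrame.{u, v}}

/-- `φ ⟺ ψ`, the conjunction of both implications. -/
def biimp (φ ψ : EF.Prp) : EF.Prp := (φ ⊃ₑ ψ) ⊓ₑ (ψ ⊃ₑ φ)

end EvidencedFrame

infix:55 " ⇔ₑ " => EvidencedFrame.biimp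

namespace EvidencedFrame

variable {EF : EvidencedFrame.{u, v}}

/-! Uniform entailment between families of propositions, with the rules of intuitionistic
predicate logic that are needed for the category structure. -/

/-- `Γ ≤ Δ` : one evidence works for all indices. -/
def Ent {I : Type w} (Γ Δ : I → EF.Prp) : Prop := ∃ e, ∀ i, EF.rel (Γ i) e (Δ i)

section Logic

variable {I : Type w} {J : Type w'} {Γ Δ φ ψ χ : I → EF.Prp}

theorem Ent.refl (Γ : I → EF.Prp) : Ent Γ Γ := ⟨EF.eId, fun _ => EF.rel_id _⟩

theorem Ent.trans (h : Ent Γ φ) (h' : Ent φ ψ) : Ent Γ ψ := by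
  obtain ⟨e, he⟩ := h
  obtain ⟨e', he'⟩ := h'
  exact ⟨EF.eComp e e', fun i => EF.rel_comp (he i) (he' i)⟩

theorem Ent.reindex (h : Ent Γ φ) (f : J → I) : Ent (fun k => Γ (f k)) (fun k => φ (f k)) := by
  obtain ⟨e, he⟩ := h
  exact ⟨e, fun k => he (f k)⟩

theorem Ent.top : Ent Γ (fun _ => EF.top) := ⟨EF.eTop, fun _ => EF.rel_top _⟩

theorem Ent.and (h : Ent Γ φ) (h' : Ent Γ ψ) : Ent Γ (fun i => φ i ⊓ₑ ψ i) := by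
  obtain ⟨e, he⟩ := h
  obtain ⟨e', he'⟩ := h'
  exact ⟨EF.ePair e e', fun i => EF.rel_pair (he i) (he' i)⟩

theorem Ent.fst (h : Ent Γ (fun i => φ i ⊓ₑ ψ i)) : Ent Γ φ :=
  h.trans ⟨EF.eFst, fun _ => EF.rel_fst _ _⟩

theorem Ent.snd (h : Ent Γ (fun i => φ i ⊓ₑ ψ i)) : Ent Γ ψ :=
  h.trans ⟨EF.eSnd, fun _ => EF.rel_snd _ _⟩

theorem Ent.lam (h : Ent (fun i => Γ i ⊓ₑ φ i) ψ) : Ent Γ (fun i => φ i ⊃ₑ ψ i) := by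
  obtain ⟨e, he⟩ := h
  refine ⟨EF.eLam e, fun i => EF.rel_lam ?_⟩
  rintro _ rfl
  exact he i

theorem Ent.ap (h : Ent Γ (fun i => φ i ⊃ₑ ψ i)) (h' : Ent Γ φ) : Ent Γ ψ :=
  (h.and h').trans ⟨EF.eEval, fun i => EF.rel_eval (φ i) {ψ i} (ψ i) rfl⟩

theorem Ent.all {X : Type w'} {φ : I → X → EF.Prp}
    (h : Ent (fun p : I × X => Γ p.1) (fun p => φ p.1 p.2)) :
    Ent Γ (fun i => EvidencedFrame.all (φ i)) := by
  obtain ⟨e, he⟩ := h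
  refine ⟨EF.eLam (EF.eComp EF.eFst e), fun i => EF.rel_lam ?_⟩
  rintro _ ⟨x, rfl⟩
  exact EF.rel_comp (EF.rel_fst _ _) (he (i, x))

theorem Ent.inst {X : Type w'} {φ : I → X → EF.Prp}
    (h : Ent Γ (fun i => EvidencedFrame.all (φ i))) (f : I → X) :
    Ent Γ (fun i => φ i (f i)) :=
  (h.and Ent.top).trans ⟨EF.eEval, fun i => EF.rel_eval _ _ _ ⟨f i, rfl⟩⟩

theorem Ent.some {X : Type w'} {φ : I → X → EF.Prp} (f : I → X)
    (h : Ent Γ (fun i => φ i (f i))) : Ent Γ (fun i => EvidencedFrame.some (φ i)) := by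
  have key : Ent (fun p : I × EF.Prp => Γ p.1)
      (fun p => prod ((fun ψ => ψ ⊃ₑ p.2) '' Set.range (φ p.1)) ⊃ₑ p.2) := by
    refine Ent.lam (Ent.ap (φ := fun p : I × EF.Prp => φ p.1 (f p.1)) ?_ ?_)
    · exact ((Ent.refl _).snd.and Ent.top).trans
        ⟨EF.eEval, fun p => EF.rel_eval _ _ _ ⟨_, ⟨f p.1, rfl⟩, rfl⟩⟩
    · exact (Ent.refl _).fst.trans (h.reindex Prod.fst)
  exact Ent.all (φ := fun i (χ : EF.Prp) =>
    prod ((fun ψ => ψ ⊃ₑ χ) '' Set.range (φ i)) ⊃ₑ χ) key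

theorem Ent.elim {X : Type w'} {φ : I → X → EF.Prp}
    (h : Ent Γ (fun i => EvidencedFrame.some (φ i)))
    (h' : Ent (fun p : I × X => Γ p.1 ⊓ₑ φ p.1 p.2) (fun p => χ p.1)) : Ent Γ χ := by
  have h1 := Ent.inst (φ := fun i (χ : EF.Prp) =>
    prod ((fun ψ => ψ ⊃ₑ χ) '' Set.range (φ i)) ⊃ₑ χ) h χ
  refine Ent.ap h1 ?_
  obtain ⟨e, he⟩ := Ent.lam h'
  refine ⟨EF.eLam (EF.eComp EF.eFst e), fun i => EF.rel_lam ?_⟩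
  rintro _ ⟨_, ⟨x, rfl⟩, rfl⟩
  exact EF.rel_comp (EF.rel_fst _ _) (he (i, x))

theorem evidenceable_all {X : Type w} {φ : X → EF.Prp} :
    Evidenceable (EvidencedFrame.all φ) ↔ Ent (fun _ => EF.top) φ := by
  constructor
  · rintro ⟨e, he⟩
    exact Ent.inst (φ := fun _ => φ) ⟨e, fun _ => he⟩ id
  · intro h
    obtain ⟨e, he⟩ := Ent.all (I := Unit) (Γ := fun _ => EF.top) (φ := fun _ => φ)
      (h.reindex Prod.snd)
    exact ⟨e, he ()⟩

theorem ent_all {X : Type w'} {φ : I → X → EF.Prp} :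
    Ent Γ (fun i => EvidencedFrame.all (φ i)) ↔
      Ent (fun p : I × X => Γ p.1) (fun p => φ p.1 p.2) :=
  ⟨fun h => Ent.inst (φ := fun p : I × X => φ p.1) (h.reindex Prod.fst) Prod.snd, Ent.all⟩

theorem ent_imp : Ent (fun _ => EF.top) (fun i => φ i ⊃ₑ ψ i) ↔ Ent φ ψ :=
  ⟨fun h => Ent.ap (Ent.top.trans h) (Ent.refl _), fun h => Ent.lam ((Ent.refl _).snd.trans h)⟩

end Logic

end EvidencedFrame

open EvidencedFrame in
/-- An object of the effectful topos of `EF`: a set with a symmetric and transitive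
`Prp`-valued equality predicate. -/
structure EFT (EF : EvidencedFrame.{u, v}) where
  carrier : Type u
  eqv : carrier → carrier → EF.Prp
  sym : Evidenceable (all fun x => all fun y => eqv x y ⊃ₑ eqv y x)
  trs : Evidenceable (all fun x => all fun y => all fun z =>
    (eqv x y ⊓ₑ eqv y z) ⊃ₑ eqv x z)

namespace EFT

open EvidencedFrame

variable {EF : EvidencedFrame.{u, v}}

/-- `ex(x) := x ∼ x`. -/
def ex (X : EFT EF) (x : X.carrier) : EF.Prp := X.eqv x x

/-- Functional predicates from `X` to `Y`. -/
structure FunPred (X Y : EFT EF) where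
  pred : X.carrier → Y.carrier → EF.Prp
  ext : Evidenceable (all fun x => all fun x' => all fun y => all fun y' =>
    (X.eqv x x' ⊓ₑ Y.eqv y y' ⊓ₑ pred x y) ⊃ₑ pred x' y')
  sv : Evidenceable (all fun x => all fun y => all fun y' =>
    ((X.ex x ⊓ₑ Y.ex y ⊓ₑ Y.ex y') ⊓ₑ pred x y ⊓ₑ pred x y') ⊃ₑ Y.eqv y y')
  tot : Evidenceable (all fun x => X.ex x ⊃ₑ EvidencedFrame.some fun y => Y.ex y ⊓ₑ pred x y)

/-- Equivalence of functional predicates. -/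
def FunPred.Equiv {X Y : EFT EF} (F G : FunPred X Y) : Prop :=
  Evidenceable (all fun x => all fun y => (X.ex x ⊓ₑ Y.ex y) ⊃ₑ (F.pred x y ⇔ₑ G.pred x y))

section Rules

variable {I : Type w} {Γ : I → EF.Prp} {X Y : EFT EF}

theorem ent_symm {x y : I → X.carrier} (h : Ent Γ (fun i => X.eqv (x i) (y i))) :
    Ent Γ (fun i => X.eqv (y i) (x i)) := by
  have := X.sym
  rw [evidenceable_all, ent_all, ent_imp] at this
  exact h.trans (this.reindex fun i => (x i, y i))

theorem ent_trans {x y z : I → X.carrier} (h : Ent Γ (fun i => X.eqv (x i) (y i)))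
    (h' : Ent Γ (fun i => X.eqv (y i) (z i))) : Ent Γ (fun i => X.eqv (x i) (z i)) := by
  have := X.trs
  rw [evidenceable_all, ent_all, ent_all, ent_imp] at this
  exact (h.and h').trans (this.reindex fun i => ((x i, y i), z i))

theorem ent_ex_left {x y : I → X.carrier} (h : Ent Γ (fun i => X.eqv (x i) (y i))) :
    Ent Γ (fun i => X.ex (x i)) := ent_trans h (ent_symm h)

theorem ent_ex_right {x y : I → X.carrier} (h : Ent Γ (fun i => X.eqv (x i) (y i))) :
    Ent Γ (fun i => X.ex (y i)) := ent_trans (ent_symm h) h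

theorem FunPred.ent_ext (F : FunPred X Y) {x x' : I → X.carrier} {y y' : I → Y.carrier}
    (hx : Ent Γ (fun i => X.eqv (x i) (x' i))) (hy : Ent Γ (fun i => Y.eqv (y i) (y' i)))
    (h : Ent Γ (fun i => F.pred (x i) (y i))) : Ent Γ (fun i => F.pred (x' i) (y' i)) := by
  have := F.ext
  rw [evidenceable_all, ent_all, ent_all, ent_all, ent_imp] at this
  exact (hx.and (hy.and h)).trans (this.reindex fun i => (((x i, x' i), y i), y' i))

theorem FunPred.ent_sv (F : FunPred X Y) {x : I → X.carrier} {y y' : I → Y.carrier}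
    (hx : Ent Γ (fun i => X.ex (x i))) (hy : Ent Γ (fun i => Y.ex (y i)))
    (hy' : Ent Γ (fun i => Y.ex (y' i))) (h : Ent Γ (fun i => F.pred (x i) (y i)))
    (h' : Ent Γ (fun i => F.pred (x i) (y' i))) : Ent Γ (fun i => Y.eqv (y i) (y' i)) := by
  have := F.sv
  rw [evidenceable_all, ent_all, ent_all, ent_imp] at this
  exact ((hx.and (hy.and hy')).and (h.and h')).trans
    (this.reindex fun i => ((x i, y i), y' i))

theorem FunPred.ent_tot (F : FunPred X Y) {x : I → X.carrier}
    (hx : Ent Γ (fun i => X.ex (x i))) :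
    Ent Γ (fun i => EvidencedFrame.some fun y => Y.ex y ⊓ₑ F.pred (x i) y) := by
  have := F.tot
  rw [evidenceable_all, ent_imp] at this
  exact hx.trans (this.reindex x)

theorem FunPred.Equiv.ent {F G : FunPred X Y} (e : F.Equiv G) {x : I → X.carrier}
    {y : I → Y.carrier} (hx : Ent Γ (fun i => X.ex (x i))) (hy : Ent Γ (fun i => Y.ex (y i)))
    (h : Ent Γ (fun i => F.pred (x i) (y i))) : Ent Γ (fun i => G.pred (x i) (y i)) := by
  have := e
  rw [FunPred.Equiv, evidenceable_all, ent_all, ent_imp] at this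
  have h1 := (hx.and hy).trans (this.reindex fun i => (x i, y i))
  exact Ent.ap (Ent.fst h1) h

theorem FunPred.equiv_of {F G : FunPred X Y}
    (h : Ent (fun p : X.carrier × Y.carrier => (X.ex p.1 ⊓ₑ Y.ex p.2) ⊓ₑ F.pred p.1 p.2)
      (fun p => G.pred p.1 p.2))
    (h' : Ent (fun p : X.carrier × Y.carrier => (X.ex p.1 ⊓ₑ Y.ex p.2) ⊓ₑ G.pred p.1 p.2)
      (fun p => F.pred p.1 p.2)) : F.Equiv G := by
  rw [FunPred.Equiv, evidenceable_all, ent_all, ent_imp]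
  exact (Ent.lam h).and (Ent.lam h')

theorem FunPred.Equiv.symm {F G : FunPred X Y} (e : F.Equiv G) : G.Equiv F := by
  have := e
  rw [FunPred.Equiv, evidenceable_all, ent_all, ent_imp] at this ⊢
  exact (Ent.snd this).and (Ent.fst this)

/-- One inclusion suffices for the equivalence of functional predicates. -/
theorem FunPred.equiv_of_le {F G : FunPred X Y}
    (h : Ent (fun p : X.carrier × Y.carrier => (X.ex p.1 ⊓ₑ Y.ex p.2) ⊓ₑ F.pred p.1 p.2)
      (fun p => G.pred p.1 p.2)) : F.Equiv G := by
  refine FunPred.equiv_of h ?_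
  have r := Ent.refl (EF := EF)
    (fun p : X.carrier × Y.carrier => (X.ex p.1 ⊓ₑ Y.ex p.2) ⊓ₑ G.pred p.1 p.2)
  refine (F.ent_tot r.fst.fst).elim ?_
  have r' := Ent.refl (EF := EF) (fun q : (X.carrier × Y.carrier) × Y.carrier =>
    ((X.ex q.1.1 ⊓ₑ Y.ex q.1.2) ⊓ₑ G.pred q.1.1 q.1.2) ⊓ₑ Y.ex q.2 ⊓ₑ F.pred q.1.1 q.2)
  have hG : Ent _ (fun q : (X.carrier × Y.carrier) × Y.carrier => G.pred q.1.1 q.2) :=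
    ((r'.fst.fst.fst.and r'.snd.fst).and r'.snd.snd).trans
      (h.reindex fun q : (X.carrier × Y.carrier) × Y.carrier => (q.1.1, q.2))
  exact F.ent_ext r'.fst.fst.fst
    (G.ent_sv r'.fst.fst.fst r'.snd.fst r'.fst.fst.snd hG r'.fst.snd) r'.snd.snd

end Rules

theorem FunPred.Equiv.refl {X Y : EFT EF} (F : FunPred X Y) : F.Equiv F :=
  FunPred.equiv_of_le (Ent.refl _).snd

theorem FunPred.Equiv.trans {X Y : EFT EF} {F G H : FunPred X Y} (e : F.Equiv G)
    (e' : G.Equiv H) : F.Equiv H := by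
  refine FunPred.equiv_of_le ?_
  have r := Ent.refl (EF := EF)
    (fun p : X.carrier × Y.carrier => (X.ex p.1 ⊓ₑ Y.ex p.2) ⊓ₑ F.pred p.1 p.2)
  exact e'.ent r.fst.fst r.fst.snd (e.ent r.fst.fst r.fst.snd r.snd)

instance funPredSetoid (X Y : EFT EF) : Setoid (FunPred X Y) where
  r := FunPred.Equiv
  iseqv := ⟨FunPred.Equiv.refl, FunPred.Equiv.symm, FunPred.Equiv.trans⟩

/-- Composition of functional predicates:
`(G ∘ F)(x, z) = ∐_y (ex(y) ∧ F(x, y) ∧ G(y, z))`. -/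
def FunPred.comp {X Y Z : EFT EF} (F : FunPred X Y) (G : FunPred Y Z) : FunPred X Z where
  pred x z := EvidencedFrame.some fun y => Y.ex y ⊓ₑ F.pred x y ⊓ₑ G.pred y z
  ext := by
    rw [evidenceable_all, ent_all, ent_all, ent_all, ent_imp]
    refine (Ent.refl _).snd.snd.elim ?_
    refine Ent.some (fun p => p.2) ?_
    have r := Ent.refl (EF := EF)
      (fun p : (((X.carrier × X.carrier) × Z.carrier) × Z.carrier) × Y.carrier =>
      (X.eqv p.1.1.1.1 p.1.1.1.2 ⊓ₑ Z.eqv p.1.1.2 p.1.2 ⊓ₑ EvidencedFrame.some fun y =>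
        Y.ex y ⊓ₑ F.pred p.1.1.1.1 y ⊓ₑ G.pred y p.1.1.2) ⊓ₑ
        Y.ex p.2 ⊓ₑ F.pred p.1.1.1.1 p.2 ⊓ₑ G.pred p.2 p.1.1.2)
    exact r.snd.fst.and ((F.ent_ext r.fst.fst r.snd.fst r.snd.snd.fst).and
      (G.ent_ext r.snd.fst r.fst.snd.fst r.snd.snd.snd))
  sv := by
    rw [evidenceable_all, ent_all, ent_all, ent_imp]
    refine (Ent.refl _).snd.fst.elim ?_
    refine (Ent.refl _).fst.snd.snd.elim ?_
    have r := Ent.refl (EF := EF)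
      (fun p : (((X.carrier × Z.carrier) × Z.carrier) × Y.carrier) × Y.carrier =>
      ((((X.ex p.1.1.1.1 ⊓ₑ Z.ex p.1.1.1.2 ⊓ₑ Z.ex p.1.1.2) ⊓ₑ
        (EvidencedFrame.some fun y => Y.ex y ⊓ₑ F.pred p.1.1.1.1 y ⊓ₑ G.pred y p.1.1.1.2) ⊓ₑ
        (EvidencedFrame.some fun y => Y.ex y ⊓ₑ F.pred p.1.1.1.1 y ⊓ₑ G.pred y p.1.1.2)) ⊓ₑ
        Y.ex p.1.2 ⊓ₑ F.pred p.1.1.1.1 p.1.2 ⊓ₑ G.pred p.1.2 p.1.1.1.2) ⊓ₑ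
        Y.ex p.2 ⊓ₑ F.pred p.1.1.1.1 p.2 ⊓ₑ G.pred p.2 p.1.1.2))
    have hy := F.ent_sv r.fst.fst.fst.fst r.fst.snd.fst r.snd.fst r.fst.snd.snd.fst r.snd.snd.fst
    exact G.ent_sv r.snd.fst r.fst.fst.fst.snd.fst r.fst.fst.fst.snd.snd
      (G.ent_ext hy r.fst.fst.fst.snd.fst r.fst.snd.snd.snd) r.snd.snd.snd
  tot := by
    rw [evidenceable_all, ent_imp]
    refine (F.ent_tot (Ent.refl _)).elim ?_
    refine (G.ent_tot (x := fun p : X.carrier × Y.carrier => p.2) (Ent.refl _).snd.fst).elim ?_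
    refine Ent.some (fun p => p.2) ?_
    have r := Ent.refl (EF := EF) (fun p : (X.carrier × Y.carrier) × Z.carrier =>
      (X.ex p.1.1 ⊓ₑ Y.ex p.1.2 ⊓ₑ F.pred p.1.1 p.1.2) ⊓ₑ Z.ex p.2 ⊓ₑ G.pred p.1.2 p.2)
    exact r.snd.fst.and (Ent.some (fun p : (X.carrier × Y.carrier) × Z.carrier => p.1.2)
      (r.fst.snd.fst.and (r.fst.snd.snd.and r.snd.snd)))

/-- A function `f` is extensional when `fext(f)` is evidenceable. -/
def IsExtensional (X Y : EFT EF) (f : X.carrier → Y.carrier) : Prop :=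
  Evidenceable (all fun x => all fun x' => X.eqv x x' ⊃ₑ Y.eqv (f x) (f x'))

/-- The lifting predicate `(x, y) ↦ f x ∼ y` of an extensional function. -/
def lift {X Y : EFT EF} (f : X.carrier → Y.carrier) (hf : IsExtensional X Y f) :
    FunPred X Y where
  pred x y := Y.eqv (f x) y
  ext := by
    rw [evidenceable_all, ent_all, ent_all, ent_all, ent_imp]
    rw [IsExtensional, evidenceable_all, ent_all, ent_imp] at hf
    have r := Ent.refl (EF := EF)
      (fun p : ((X.carrier × X.carrier) × Y.carrier) × Y.carrier =>
      (X.eqv p.1.1.1 p.1.1.2 ⊓ₑ Y.eqv p.1.2 p.2 ⊓ₑ Y.eqv (f p.1.1.1) p.1.2))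
    have h := r.fst.trans
      (hf.reindex fun p : ((X.carrier × X.carrier) × Y.carrier) × Y.carrier => p.1.1)
    exact ent_trans (ent_symm h) (ent_trans r.snd.snd r.snd.fst)
  sv := by
    rw [evidenceable_all, ent_all, ent_all, ent_imp]
    exact ent_trans (ent_symm (Ent.refl _).snd.fst) (Ent.refl _).snd.snd
  tot := by
    rw [evidenceable_all, ent_imp]
    rw [IsExtensional, evidenceable_all, ent_all, ent_imp] at hf
    have h := hf.reindex fun x : X.carrier => (x, x)
    exact Ent.some f (h.and h)

theorem isExtensional_id (X : EFT EF) : IsExtensional X X id := by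
  rw [IsExtensional, evidenceable_all, ent_all, ent_imp]
  exact Ent.refl _

/-- The category of objects and equivalence classes of functional predicates. -/
instance : Category (EFT EF) where
  Hom X Y := Quotient (funPredSetoid X Y)
  id X := Quotient.mk _ (lift id (isExtensional_id X))
  comp {X Y Z} := Quotient.map₂ FunPred.comp (by
    intro F F' hF G G' hG
    refine FunPred.equiv_of_le ?_
    refine (Ent.refl _).snd.elim ?_
    refine Ent.some (fun p => p.2) ?_
    have r := Ent.refl (EF := EF) (fun p : (X.carrier × Z.carrier) × Y.carrier =>
      ((X.ex p.1.1 ⊓ₑ Z.ex p.1.2) ⊓ₑ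
        EvidencedFrame.some fun y => Y.ex y ⊓ₑ F.pred p.1.1 y ⊓ₑ G.pred y p.1.2) ⊓ₑ
      Y.ex p.2 ⊓ₑ F.pred p.1.1 p.2 ⊓ₑ G.pred p.2 p.1.2)
    exact r.snd.fst.and ((FunPred.Equiv.ent hF r.fst.fst.fst r.snd.fst r.snd.snd.fst).and
      (FunPred.Equiv.ent hG r.snd.fst r.fst.fst.snd r.snd.snd.snd)))
  id_comp {X Y} f := by
    induction f using Quotient.inductionOn with | _ F => ?_
    refine Quotient.sound (FunPred.equiv_of_le ?_)
    refine (Ent.refl _).snd.elim ?_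
    have r := Ent.refl (EF := EF) (fun p : (X.carrier × Y.carrier) × X.carrier =>
      ((X.ex p.1.1 ⊓ₑ Y.ex p.1.2) ⊓ₑ
        EvidencedFrame.some fun y => X.ex y ⊓ₑ X.eqv p.1.1 y ⊓ₑ F.pred y p.1.2) ⊓ₑ
      X.ex p.2 ⊓ₑ X.eqv p.1.1 p.2 ⊓ₑ F.pred p.2 p.1.2)
    exact F.ent_ext (ent_symm r.snd.snd.fst) r.fst.fst.snd r.snd.snd.snd
  comp_id {X Y} f := by
    induction f using Quotient.inductionOn with | _ F => ?_
    refine Quotient.sound (FunPred.equiv_of_le ?_)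
    refine (Ent.refl _).snd.elim ?_
    have r := Ent.refl (EF := EF) (fun p : (X.carrier × Y.carrier) × Y.carrier =>
      ((X.ex p.1.1 ⊓ₑ Y.ex p.1.2) ⊓ₑ
        EvidencedFrame.some fun y => Y.ex y ⊓ₑ F.pred p.1.1 y ⊓ₑ Y.eqv y p.1.2) ⊓ₑ
      Y.ex p.2 ⊓ₑ F.pred p.1.1 p.2 ⊓ₑ Y.eqv p.2 p.1.2)
    exact F.ent_ext r.fst.fst.fst r.snd.snd.snd r.snd.snd.fst
  assoc {W X Y Z} f g h := by
    induction f using Quotient.inductionOn with | _ F => ?_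
    induction g using Quotient.inductionOn with | _ G => ?_
    induction h using Quotient.inductionOn with | _ H => ?_
    refine Quotient.sound (FunPred.equiv_of_le ?_)
    refine (Ent.refl _).snd.elim ?_
    refine (Ent.refl _).snd.snd.fst.elim ?_
    refine Ent.some (fun p => p.2) ?_
    have r := Ent.refl (EF := EF)
      (fun p : ((W.carrier × Z.carrier) × Y.carrier) × X.carrier =>
      (((W.ex p.1.1.1 ⊓ₑ Z.ex p.1.1.2) ⊓ₑ ((F.comp G).comp H).pred p.1.1.1 p.1.1.2) ⊓ₑ
        Y.ex p.1.2 ⊓ₑ (F.comp G).pred p.1.1.1 p.1.2 ⊓ₑ H.pred p.1.2 p.1.1.2) ⊓ₑ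
      X.ex p.2 ⊓ₑ F.pred p.1.1.1 p.2 ⊓ₑ G.pred p.2 p.1.2)
    exact r.snd.fst.and (r.snd.snd.fst.and
      (Ent.some (fun p : ((W.carrier × Z.carrier) × Y.carrier) × X.carrier => p.1.2)
        (r.fst.snd.fst.and (r.snd.snd.snd.and r.fst.snd.snd.snd))))

/-- The morphism represented by a functional predicate. -/
def FunPred.hom {X Y : EFT EF} (F : FunPred X Y) : X ⟶ Y := Quotient.mk _ F

/-- The terminal object: a singleton whose only element exists. -/
def one (EF : EvidencedFrame.{u, v}) : EFT EF where
  carrier := PUnit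
  eqv _ _ := EF.top
  sym := by
    rw [evidenceable_all, ent_all, ent_imp]
    exact Ent.top
  trs := by
    rw [evidenceable_all, ent_all, ent_all, ent_imp]
    exact Ent.top

theorem isExtensional_toOne (X : EFT EF) :
    IsExtensional X (one EF) (fun _ => PUnit.unit) := by
  unfold IsExtensional
  rw [evidenceable_all, ent_all, ent_imp]
  exact Ent.top

/-- The morphism to the terminal object. -/
def toOne (X : EFT EF) : X ⟶ one EF := (lift _ (isExtensional_toOne X)).hom

/-- The object of propositions, with bi-implication as equality. -/
def omega (EF : EvidencedFrame.{u, v}) : EFT EF where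
  carrier := EF.Prp
  eqv φ ψ := φ ⇔ₑ ψ
  sym := by
    rw [evidenceable_all, ent_all, ent_imp]
    exact (Ent.refl _).snd.and (Ent.refl _).fst
  trs := by
    rw [evidenceable_all, ent_all, ent_all, ent_imp]
    have r := Ent.refl (EF := EF)
      (fun p : (EF.Prp × EF.Prp) × EF.Prp => (p.1.1 ⇔ₑ p.1.2) ⊓ₑ (p.1.2 ⇔ₑ p.2))
    have r1 := r.fst
    have r2 := r.snd
    refine Ent.and (Ent.lam ?_) (Ent.lam ?_)
    · exact Ent.ap ((Ent.refl _).fst.trans r2.fst)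
        (Ent.ap ((Ent.refl _).fst.trans r1.fst) (Ent.refl _).snd)
    · exact Ent.ap ((Ent.refl _).fst.trans r1.snd)
        (Ent.ap ((Ent.refl _).fst.trans r2.snd) (Ent.refl _).snd)

theorem isExtensional_truth (EF : EvidencedFrame.{u, v}) :
    IsExtensional (one EF) (omega EF) (fun _ => EF.top) := by
  unfold IsExtensional
  rw [evidenceable_all, ent_all, ent_imp]
  exact Ent.and (Ent.lam Ent.top) (Ent.lam Ent.top)

/-- The morphism `true`, represented by the function with value `⊤`. -/
def truth (EF : EvidencedFrame.{u, v}) : one EF ⟶ omega EF :=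
  (lift _ (isExtensional_truth EF)).hom

/-- `χ` is a classifying morphism of `m`: `m` is the pullback of `true` along `χ`. -/
def Classifies {S X : EFT EF} (χ : X ⟶ omega EF) (m : S ⟶ X) : Prop :=
  IsPullback m (toOne S) χ (truth EF)

/-- A Lawvere–Tierney topology: an extensional function on propositions (hence an endomorphism
of the object of propositions) that is inflationary, idempotent and preserves conjunction, all
of this uniformly evidenced. -/
structure LTTopology (EF : EvidencedFrame.{u, v}) where
  toFun : EF.Prp → EF.Prp
  fext : IsExtensional (omega EF) (omega EF) toFun
  inc : Evidenceable (all fun φ : EF.Prp => φ ⊃ₑ toFun φ)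
  idm : Evidenceable (all fun φ : EF.Prp => toFun (toFun φ) ⊃ₑ toFun φ)
  prs : Evidenceable (all fun φ : EF.Prp => all fun ψ : EF.Prp =>
    toFun (φ ⊓ₑ ψ) ⇔ₑ (toFun φ ⊓ₑ toFun ψ))

instance : CoeFun (LTTopology EF) (fun _ => EF.Prp → EF.Prp) := ⟨LTTopology.toFun⟩

/-- The endomorphism of the object of propositions represented by a topology. -/
def LTTopology.hom (j : LTTopology EF) : omega EF ⟶ omega EF :=
  (lift j.toFun j.fext).hom

/-- `mbar` is a `j`-closure of `m`: it is classified by `j ∘ χ`, where `χ` classifies `m`. -/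
def IsClosure (j : LTTopology EF) {S Sbar X : EFT EF} (m : S ⟶ X) (mbar : Sbar ⟶ X) : Prop :=
  ∃ χ : X ⟶ omega EF, Classifies χ m ∧ Classifies (χ ≫ j.hom) mbar

/-- `m` is `j`-dense: its `j`-closure is all of `X`, as a subobject of `X`. -/
def IsDense (j : LTTopology EF) {S X : EFT EF} (m : S ⟶ X) : Prop :=
  ∃ (Sbar : EFT EF) (mbar : Sbar ⟶ X), IsClosure j m mbar ∧ IsIso mbar

/-- `A` is `j`-separated: restriction along `j`-dense monomorphisms is injective. -/
def IsSeparated (j : LTTopology EF) (A : EFT EF) : Prop :=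
  ∀ ⦃S X : EFT EF⦄ (m : S ⟶ X), Mono m → IsDense j m →
    Function.Injective (fun f : X ⟶ A => m ≫ f)

/-- `A` is a `j`-sheaf: restriction along `j`-dense monomorphisms is bijective. -/
def IsSheaf (j : LTTopology EF) (A : EFT EF) : Prop :=
  ∀ ⦃S X : EFT EF⦄ (m : S ⟶ X), Mono m → IsDense j m →
    Function.Bijective (fun f : X ⟶ A => m ≫ f)

/-- The proposition `sep(A)`. -/
def sep (j : LTTopology EF) (A : EFT EF) : EF.Prp :=
  all fun a : A.carrier => all fun b : A.carrier =>
    ((A.ex a ⊓ₑ A.ex b) ⊓ₑ j (A.eqv a b)) ⊃ₑ A.eqv a b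

/-- The `j`-singleton `ψ_x(a) = j (∐_s (ex(s) ∧ M(s, x) ∧ G(s, a)))` for functional predicates
`M` and `G` that represent `m : S ⟶ X` and `g : S ⟶ A`. When `M` and `G` are the liftings of
functions `m` and `g`, `M(s, x)` is `m(s) ∼ x` and `G(s, a)` is `g(s) ∼ a`. -/
def singleton (j : LTTopology EF) {S X A : EFT EF} (M : FunPred S X) (G : FunPred S A)
    (x : X.carrier) (a : A.carrier) : EF.Prp :=
  j (EvidencedFrame.some fun s : S.carrier => S.ex s ⊓ₑ M.pred s x ⊓ₑ G.pred s a)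

/-- The proposition `dsc(A)` for given `M` and `G`. -/
def dsc (j : LTTopology EF) {S X A : EFT EF} (M : FunPred S X) (G : FunPred S A) : EF.Prp :=
  all fun x : X.carrier => X.ex x ⊃ₑ EvidencedFrame.some fun a : A.carrier =>
    A.ex a ⊓ₑ all fun b : A.carrier =>
      A.ex b ⊃ₑ (singleton j M G x b ⇔ₑ j (A.eqv a b))

end EFT

namespace KleeneOne

/-- Kleene application `a · b = φ_a(b)` on natural numbers. -/
def app (a b : ℕ) : Part ℕ := (Denumerable.ofNat Nat.Partrec.Code a).eval b

/-- The modality: `φ` holds of the value of a computation, which in particular must exist. -/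
def modality (m : Part ℕ) (φ : ℕ → Prop) : Prop := ∃ r ∈ m, φ r

/-- The evidence relation. -/
def rel (φ : ℕ → Prop) (e : ℕ) (ψ : ℕ → Prop) : Prop := ∀ c, φ c → modality (app e c) ψ

theorem exists_index {f : ℕ →. ℕ} (hf : Nat.Partrec f) : ∃ e, app e = f := by
  obtain ⟨c, hc⟩ := Nat.Partrec.Code.exists_code.1 hf
  exact ⟨Encodable.encode c, by funext n; simp [app, hc]⟩

theorem exists_id : ∃ e, ∀ c, app e c = Part.some c := by
  obtain ⟨e, he⟩ := exists_index (f := fun c => Part.some c) Nat.Partrec.some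
  exact ⟨e, fun c => by rw [he]⟩

theorem exists_fst : ∃ e, ∀ c, app e c = Part.some c.unpair.1 := by
  obtain ⟨e, he⟩ := exists_index Nat.Partrec.left
  exact ⟨e, fun c => by rw [he]; rfl⟩

theorem exists_snd : ∃ e, ∀ c, app e c = Part.some c.unpair.2 := by
  obtain ⟨e, he⟩ := exists_index Nat.Partrec.right
  exact ⟨e, fun c => by rw [he]; rfl⟩

theorem exists_comp (e₁ e₂ : ℕ) : ∃ e, ∀ c, app e c = (app e₁ c).bind (app e₂) := by
  refine ⟨Encodable.encode (Nat.Partrec.Code.comp (Denumerable.ofNat _ e₂)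
    (Denumerable.ofNat _ e₁)), fun c => ?_⟩
  simp only [app, Denumerable.ofNat_encode]
  rfl

theorem exists_pair (e₁ e₂ : ℕ) : ∃ e, ∀ c, app e c =
    (app e₁ c).bind fun a => (app e₂ c).bind fun b => Part.some (Nat.pair a b) := by
  refine ⟨Encodable.encode (Nat.Partrec.Code.pair (Denumerable.ofNat _ e₁)
    (Denumerable.ofNat _ e₂)), fun c => ?_⟩
  simp only [app, Denumerable.ofNat_encode]
  simp [Nat.Partrec.Code.eval, Seq.seq, Part.bind_some_eq_map]

theorem exists_lam (e : ℕ) : ∃ l, ∀ a, ∃ r ∈ app l a, ∀ b, app r b = app e (Nat.pair a b) := by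
  have h : Computable fun a : ℕ =>
      Encodable.encode (Nat.Partrec.Code.curry (Denumerable.ofNat _ e) a) :=
    Computable.encode.comp
      (Nat.Partrec.Code.primrec₂_curry.to_comp.comp (Computable.const _) Computable.id)
  obtain ⟨l, hl⟩ := exists_index (Partrec.nat_iff.1 h.partrec)
  refine ⟨l, fun a => ⟨_, by rw [hl]; exact Part.mem_some _, fun b => ?_⟩⟩
  simp [app, Nat.Partrec.Code.eval_curry]

theorem exists_eval : ∃ e, ∀ a b, app e (Nat.pair a b) = app a b := by
  have h : Partrec fun n : ℕ => app n.unpair.1 n.unpair.2 :=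
    Nat.Partrec.Code.eval_part.comp
      ((Computable.ofNat _).comp (Computable.fst.comp Computable.unpair))
      (Computable.snd.comp Computable.unpair)
  obtain ⟨e, he⟩ := exists_index (Partrec.nat_iff.1 h)
  exact ⟨e, fun a b => by rw [he]; simp⟩

end KleeneOne

open KleeneOne in
/-- The evidenced frame of Kleene's first model: propositions are predicates on codes (truth
values being `Prop`), all codes are evidences, conjunction is by pairs of realizers and universal
implication by uniform computations. -/
noncomputable def kleeneEF : EvidencedFrame.{0, 0} where
  Prp := ℕ → Prop
  Evd := ℕ
  rel := rel
  eId := exists_id.choose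
  rel_id φ c hc := ⟨c, by rw [exists_id.choose_spec]; exact Part.mem_some _, hc⟩
  eComp e₁ e₂ := (exists_comp e₁ e₂).choose
  rel_comp {_ _ _ e₁ e₂} h₁ h₂ c hc := by
    obtain ⟨a, ha, ha'⟩ := h₁ c hc
    obtain ⟨b, hb, hb'⟩ := h₂ a ha'
    exact ⟨b, by rw [(exists_comp e₁ e₂).choose_spec]; exact Part.mem_bind ha hb, hb'⟩
  top := fun _ => True
  eTop := exists_id.choose
  rel_top φ c hc := ⟨c, by rw [exists_id.choose_spec]; exact Part.mem_some _, trivial⟩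
  and φ ψ := fun c => φ c.unpair.1 ∧ ψ c.unpair.2
  ePair e₁ e₂ := (exists_pair e₁ e₂).choose
  eFst := exists_fst.choose
  eSnd := exists_snd.choose
  rel_pair {_ _ _ e₁ e₂} h₁ h₂ c hc := by
    obtain ⟨a, ha, ha'⟩ := h₁ c hc
    obtain ⟨b, hb, hb'⟩ := h₂ c hc
    refine ⟨Nat.pair a b, ?_, by simpa using ⟨ha', hb'⟩⟩
    rw [(exists_pair e₁ e₂).choose_spec]
    exact Part.mem_bind ha (Part.mem_bind hb (Part.mem_some _))
  rel_fst φ ψ c hc := ⟨_, by rw [exists_fst.choose_spec]; exact Part.mem_some _, hc.1⟩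
  rel_snd φ ψ c hc := ⟨_, by rw [exists_snd.choose_spec]; exact Part.mem_some _, hc.2⟩
  uimp φ Ψ := fun e => ∀ ψ ∈ Ψ, rel φ e ψ
  eLam e := (exists_lam e).choose
  eEval := exists_eval.choose
  rel_lam {φ₁ φ₂ e Ψ} h c hc := by
    obtain ⟨r, hr, hr'⟩ := (exists_lam e).choose_spec c
    refine ⟨r, hr, fun ψ hψ b hb => ?_⟩
    rw [hr']
    exact h ψ hψ (Nat.pair c b) (by simpa using ⟨hc, hb⟩)
  rel_eval φ Ψ ψ hψ c hc := by
    have h := hc.1 ψ hψ _ hc.2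
    rwa [← exists_eval.choose_spec, Nat.pair_unpair] at h

/-!
The theorem holds over every evidenced frame, because all its parts can be carried out in the
internal logic, where `j` is a modality: it is monotone in context, so that one may reason under
`j` (`LTTopology.ent_map`, `LTTopology.ent_bind`).

The bridge to the category is a logical description of density. If `m : S ⟶ X` is `j`-dense and
represented by `M`, then every existing `x` satisfies `j (∃ s, M(s, x))` (`IsDense.ent_image`):
where the classifying morphism of `m` is true, a subobject of `X` is cut out that factors through
`m` because `m` is a pullback of `true`. Conversely, the inclusion of `{x ∈ X | P x}` is dense
when every existing `x` satisfies `j (P x)` (`isDense_incl`).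

* Separated objects. If `sep(A)` holds and `f`, `g` agree on a dense `S`, then
  `j (f x ∼ g x)` for every `x`, hence `f x ∼ g x`. Conversely, the diagonal of `A × A` is dense in
  `{(a, b) | j (a ∼ b)}`; the two projections agree on it, hence everywhere, and this is `sep(A)`.
* Sheaves. If `F` extends `G` along a dense `M`, then the value `F(x)` describes the `j`-singleton
  `ψ_x`, which gives `dsc(A)`. Conversely, when `sep(A)` and `dsc(A)` hold, the relation `ψ_x(a)`
  is itself a functional predicate from `X` to `A` that extends `G` (`singletonPred`).
-/

namespace EFT

open EvidencedFrame

variable {EF : EvidencedFrame.{u, v}}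

theorem isExtensional_iff {X Y : EFT EF} {f : X.carrier → Y.carrier} :
    IsExtensional X Y f ↔
      Ent (fun p : X.carrier × X.carrier => X.eqv p.1 p.2)
        (fun p => Y.eqv (f p.1) (f p.2)) := by
  unfold IsExtensional
  rw [evidenceable_all, ent_all, ent_imp]

/-! ### Topologies as modalities on entailment -/

namespace LTTopology

variable {I : Type w} {Γ φ ψ : I → EF.Prp} (j : LTTopology EF)

theorem ent_unit (h : Ent Γ φ) : Ent Γ (fun i => j (φ i)) := by
  have := j.inc
  rw [evidenceable_all, ent_imp] at this
  exact h.trans (this.reindex φ)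

/-- A topology is monotone in context: `φ` entails `ψ` precisely when `φ` is equivalent to
`φ ∧ ψ`, an equivalence that `j` preserves by extensionality. -/
theorem ent_map (h : Ent Γ (fun i => j (φ i))) (h' : Ent (fun i => Γ i ⊓ₑ φ i) ψ) :
    Ent Γ (fun i => j (ψ i)) := by
  have hext := isExtensional_iff.1 j.fext
  have hprs := j.prs
  rw [evidenceable_all, ent_all] at hprs
  have hequiv : Ent Γ (fun i => φ i ⇔ₑ (φ i ⊓ₑ ψ i)) :=
    Ent.and (Ent.lam ((Ent.refl _).snd.and h')) (Ent.lam (Ent.refl _).snd.fst)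
  have hj : Ent Γ (fun i => j (φ i) ⇔ₑ j (φ i ⊓ₑ ψ i)) :=
    hequiv.trans (hext.reindex fun i => (φ i, φ i ⊓ₑ ψ i))
  have hand : Ent Γ (fun i => j (φ i ⊓ₑ ψ i) ⇔ₑ (j (φ i) ⊓ₑ j (ψ i))) :=
    Ent.top.trans (hprs.reindex fun i => (φ i, ψ i))
  exact (hand.fst.ap (hj.fst.ap h)).snd

theorem ent_bind (h : Ent Γ (fun i => j (φ i)))
    (h' : Ent (fun i => Γ i ⊓ₑ φ i) (fun i => j (ψ i))) : Ent Γ (fun i => j (ψ i)) := by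
  have := j.idm
  rw [evidenceable_all, ent_imp] at this
  exact (j.ent_map h h').trans (this.reindex ψ)

end LTTopology

/-! ### Morphisms and their representatives -/

theorem exists_hom_eq {X Y : EFT EF} (f : X ⟶ Y) : ∃ F : FunPred X Y, F.hom = f :=
  Quotient.exists_rep f

theorem hom_eq_iff {X Y : EFT EF} {F G : FunPred X Y} : F.hom = G.hom ↔ F.Equiv G :=
  Quotient.eq

theorem hom_comp {X Y Z : EFT EF} (F : FunPred X Y) (G : FunPred Y Z) :
    F.hom ≫ G.hom = (F.comp G).hom := rfl

theorem FunPred.ent_comp {X Y Z : EFT EF} {F : FunPred X Y} {G : FunPred Y Z} {I : Type w}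
    {Γ : I → EF.Prp} {x : I → X.carrier} {y : I → Y.carrier} {z : I → Z.carrier}
    (hy : Ent Γ (fun i => Y.ex (y i))) (hF : Ent Γ (fun i => F.pred (x i) (y i)))
    (hG : Ent Γ (fun i => G.pred (y i) (z i))) :
    Ent Γ (fun i => (F.comp G).pred (x i) (z i)) :=
  Ent.some y (hy.and (hF.and hG))

/-- Since `F` is single-valued, `y` may be taken as the intermediate element that witnesses
`G ∘ F` as soon as `F(x, y)`. -/
theorem FunPred.ent_of_comp {X Y Z : EFT EF} {F : FunPred X Y} {G : FunPred Y Z} {I : Type w}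
    {Γ : I → EF.Prp} {x : I → X.carrier} {y : I → Y.carrier} {z : I → Z.carrier}
    (hx : Ent Γ (fun i => X.ex (x i))) (hy : Ent Γ (fun i => Y.ex (y i)))
    (hz : Ent Γ (fun i => Z.ex (z i))) (hF : Ent Γ (fun i => F.pred (x i) (y i)))
    (h : Ent Γ (fun i => (F.comp G).pred (x i) (z i))) :
    Ent Γ (fun i => G.pred (y i) (z i)) := by
  refine h.elim ?_
  have r := Ent.refl (EF := EF) (fun p : I × Y.carrier => Γ p.1 ⊓ₑ
    Y.ex p.2 ⊓ₑ F.pred (x p.1) p.2 ⊓ₑ G.pred p.2 (z p.1))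
  exact G.ent_ext (F.ent_sv (r.fst.trans (hx.reindex Prod.fst)) r.snd.fst
    (r.fst.trans (hy.reindex Prod.fst)) r.snd.snd.fst (r.fst.trans (hF.reindex Prod.fst)))
    (r.fst.trans (hz.reindex Prod.fst)) r.snd.snd.snd

theorem toOne_unique {X : EFT EF} (f : X ⟶ one EF) : f = toOne X := by
  obtain ⟨F, rfl⟩ := exists_hom_eq f
  exact hom_eq_iff.2 (FunPred.equiv_of_le Ent.top)

theorem ent_omega_ex {I : Type w} {Γ : I → EF.Prp} {φ : I → EF.Prp} :
    Ent Γ (fun i => (omega EF).ex (φ i)) :=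
  Ent.and (Ent.lam (Ent.refl _).snd) (Ent.lam (Ent.refl _).snd)

/-- A morphism to the object of propositions is constantly true exactly when any predicate that
represents it relates each existing element to `⊤`. -/
theorem hom_eq_truth_iff {X : EFT EF} {C : FunPred X (omega EF)} :
    C.hom = toOne X ≫ truth EF ↔ Ent X.ex (fun x => C.pred x EF.top) := by
  rw [toOne, truth, hom_comp, hom_eq_iff]
  constructor
  · intro h
    refine FunPred.Equiv.ent (x := id) h.symm (Ent.refl _) ent_omega_ex ?_
    refine Ent.some (fun _ => PUnit.unit) ?_
    exact Ent.top.and (Ent.top.and ent_omega_ex)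
  · intro h
    refine FunPred.equiv_of_le ?_
    have r := Ent.refl (EF := EF) (fun p : X.carrier × EF.Prp =>
      (X.ex p.1 ⊓ₑ (omega EF).ex p.2) ⊓ₑ C.pred p.1 p.2)
    refine Ent.some (fun _ => PUnit.unit) (Ent.top.and (Ent.top.and ?_))
    exact C.ent_sv r.fst.fst ent_omega_ex r.fst.snd (r.fst.fst.trans (h.reindex Prod.fst)) r.snd

/-! ### Subobjects cut out by predicates -/

/-- The predicate `P` respects the equality of `X`. -/
def IsStable (X : EFT EF) (P : X.carrier → EF.Prp) : Prop :=
  Ent (fun p : X.carrier × X.carrier => X.eqv p.1 p.2 ⊓ₑ P p.1) (fun p => P p.2)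

theorem IsStable.ent {X : EFT EF} {P : X.carrier → EF.Prp} (hP : IsStable X P) {I : Type w}
    {Γ : I → EF.Prp} {x y : I → X.carrier} (h : Ent Γ (fun i => X.eqv (x i) (y i)))
    (h' : Ent Γ (fun i => P (x i))) : Ent Γ (fun i => P (y i)) :=
  (h.and h').trans (hP.reindex fun i => (x i, y i))

/-- The subobject `{x ∈ X | P x}`: the carrier is unchanged, and equality, hence existence, also
requires `P`. -/
def sub (X : EFT EF) (P : X.carrier → EF.Prp) (hP : IsStable X P) : EFT EF where
  carrier := X.carrier
  eqv x y := X.eqv x y ⊓ₑ P x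
  sym := by
    rw [evidenceable_all, ent_all, ent_imp]
    exact (ent_symm (Ent.refl _).fst).and (hP.ent (Ent.refl _).fst (Ent.refl _).snd)
  trs := by
    rw [evidenceable_all, ent_all, ent_all, ent_imp]
    exact (ent_trans (Ent.refl _).fst.fst (Ent.refl _).snd.fst).and (Ent.refl _).fst.snd

variable {X : EFT EF} {P : X.carrier → EF.Prp} (hP : IsStable X P)

theorem isExtensional_incl : IsExtensional (sub X P hP) X (fun x => x) :=
  isExtensional_iff.2 (Ent.refl _).fst

/-- The functional predicate `x ∼ y` that represents the inclusion of `{x ∈ X | P x}`. -/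
def inclPred : FunPred (sub X P hP) X := lift _ (isExtensional_incl hP)

/-- The inclusion of `{x ∈ X | P x}` into `X`. -/
def incl : sub X P hP ⟶ X := (inclPred hP).hom

theorem IsStable.isExtensional {X : EFT EF} {P : X.carrier → EF.Prp} (hP : IsStable X P) :
    IsExtensional X (omega EF) P :=
  isExtensional_iff.2 (Ent.and (Ent.lam (hP.ent (Ent.refl _).fst (Ent.refl _).snd))
    (Ent.lam (hP.ent (ent_symm (Ent.refl _).fst) (Ent.refl _).snd)))

/-- The classifying morphism of `{x ∈ X | P x}`. -/
def char : X ⟶ omega EF := (lift P hP.isExtensional).hom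

/-- Composition with the inclusion does not change the underlying predicate. -/
theorem comp_incl_pred {T : EFT EF} (F : FunPred T (sub X P hP)) {I : Type w} {Γ : I → EF.Prp}
    {t : I → T.carrier} {x : I → X.carrier} (ht : Ent Γ (fun i => T.ex (t i)))
    (h : Ent Γ (fun i => (F.comp (inclPred hP)).pred (t i) (x i))) :
    Ent Γ (fun i => F.pred (t i) (x i)) := by
  refine h.elim ?_
  have r := Ent.refl (EF := EF) (fun p : I × X.carrier => Γ p.1 ⊓ₑ
    (X.ex p.2 ⊓ₑ P p.2) ⊓ₑ F.pred (t p.1) p.2 ⊓ₑ X.eqv p.2 (x p.1))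
  exact F.ent_ext (x := fun p : I × X.carrier => t p.1) (x' := fun p => t p.1)
    (y := fun p => p.2) (y' := fun p => x p.1) (r.fst.trans (ht.reindex Prod.fst))
    (r.snd.snd.snd.and r.snd.fst.snd) r.snd.snd.fst

instance mono_incl : Mono (incl hP) where
  right_cancellation {T} f g h := by
    obtain ⟨F, rfl⟩ := exists_hom_eq f
    obtain ⟨G, rfl⟩ := exists_hom_eq g
    rw [incl, hom_comp, hom_comp, hom_eq_iff] at h
    refine hom_eq_iff.2 (FunPred.equiv_of_le ?_)
    have r := Ent.refl (EF := EF) (fun p : T.carrier × X.carrier =>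
      (T.ex p.1 ⊓ₑ X.ex p.2 ⊓ₑ P p.2) ⊓ₑ F.pred p.1 p.2)
    refine comp_incl_pred hP G (Γ := fun p : T.carrier × X.carrier =>
      (T.ex p.1 ⊓ₑ X.ex p.2 ⊓ₑ P p.2) ⊓ₑ F.pred p.1 p.2) (t := Prod.fst) (x := Prod.snd)
      r.fst.fst (FunPred.Equiv.ent h r.fst.fst r.fst.snd.fst ?_)
    exact Ent.some Prod.snd (r.fst.snd.and (r.snd.and r.fst.snd.fst))

/-- If `P` is true along `F`, then `P` holds of all values of `F`. -/
theorem ent_comp_char {T : EFT EF} {F : FunPred T X}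
    (h : F.hom ≫ char hP = toOne T ≫ truth EF) {I : Type w} {Γ : I → EF.Prp}
    {t : I → T.carrier} {x : I → X.carrier} (ht : Ent Γ (fun i => T.ex (t i)))
    (hx : Ent Γ (fun i => X.ex (x i))) (hF : Ent Γ (fun i => F.pred (t i) (x i))) :
    Ent Γ (fun i => P (x i)) := by
  rw [char, hom_comp, hom_eq_truth_iff] at h
  exact Ent.ap (FunPred.ent_of_comp ht hx ent_omega_ex hF (ht.trans (h.reindex t))).snd Ent.top

/-- The factorization through `{x ∈ X | P x}` of a functional predicate whose values satisfy
`P`. -/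
def corestrict {T : EFT EF} (F : FunPred T X)
    (h : F.hom ≫ char hP = toOne T ≫ truth EF) : FunPred T (sub X P hP) where
  pred := F.pred
  ext := by
    rw [evidenceable_all, ent_all, ent_all, ent_all, ent_imp]
    exact F.ent_ext (Ent.refl _).fst (Ent.refl _).snd.fst.fst (Ent.refl _).snd.snd
  sv := by
    rw [evidenceable_all, ent_all, ent_all, ent_imp]
    exact (F.ent_sv (Ent.refl _).fst.fst (Ent.refl _).fst.snd.fst.fst
      (Ent.refl _).fst.snd.snd.fst (Ent.refl _).snd.fst (Ent.refl _).snd.snd).and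
      (Ent.refl _).fst.snd.fst.snd
  tot := by
    rw [evidenceable_all, ent_imp]
    refine (F.ent_tot (Ent.refl _)).elim (Ent.some Prod.snd ?_)
    have r := Ent.refl (EF := EF) (fun p : T.carrier × X.carrier =>
      T.ex p.1 ⊓ₑ X.ex p.2 ⊓ₑ F.pred p.1 p.2)
    exact (r.snd.fst.and (ent_comp_char hP h r.fst r.snd.fst r.snd.snd)).and r.snd.snd

theorem corestrict_incl {T : EFT EF} (F : FunPred T X)
    (h : F.hom ≫ char hP = toOne T ≫ truth EF) :
    (corestrict hP F h).hom ≫ incl hP = F.hom := by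
  rw [incl, hom_comp, hom_eq_iff]
  refine FunPred.equiv_of_le ?_
  have r := Ent.refl (EF := EF) (fun p : T.carrier × X.carrier => (T.ex p.1 ⊓ₑ X.ex p.2) ⊓ₑ
    ((corestrict hP F h).comp (inclPred hP)).pred p.1 p.2)
  exact comp_incl_pred hP _ r.fst.fst r.snd

theorem incl_char : incl hP ≫ char hP = toOne _ ≫ truth EF := by
  rw [char, incl, hom_comp, hom_eq_truth_iff]
  have r := Ent.refl (EF := EF) (fun x : X.carrier => X.ex x ⊓ₑ P x)
  exact Ent.some id (r.fst.and (r.fst.and (Ent.and (Ent.lam Ent.top)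
    (Ent.lam ((Ent.refl _).fst.snd)))))

theorem classifies_incl : Classifies (char hP) (incl hP) := by
  refine ⟨⟨(incl_char hP).trans (by rw [toOne_unique (toOne _)])⟩, ⟨?_⟩⟩
  have hlift : ∀ s : Limits.PullbackCone (char hP) (truth EF),
      ∃ l : s.pt ⟶ sub X P hP, l ≫ incl hP = s.fst := by
    intro s
    obtain ⟨F, hF⟩ := exists_hom_eq s.fst
    have h : F.hom ≫ char hP = toOne _ ≫ truth EF := by
      rw [hF, s.condition, toOne_unique s.snd]
    exact ⟨_, (corestrict_incl hP F h).trans hF⟩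
  choose l hl using hlift
  refine Limits.PullbackCone.IsLimit.mk _ l hl
    (fun s => (toOne_unique _).trans (toOne_unique _).symm) (fun s t ht _ => ?_)
  rw [← cancel_mono (incl hP), ht, hl]

/-! ### Dense monomorphisms -/

/-- The identity is classified by the constantly true morphism. -/
theorem classifies_id (X : EFT EF) : Classifies (toOne X ≫ truth EF) (𝟙 X) := by
  refine ⟨⟨by rw [Category.id_comp]⟩, ⟨?_⟩⟩
  exact Limits.PullbackCone.IsLimit.mk _ (fun s => s.fst) (fun s => Category.comp_id _)
    (fun s => (toOne_unique _).trans (toOne_unique _).symm)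
    (fun s t ht _ => (Category.comp_id t).symm.trans ht)

theorem isDense_incl (j : LTTopology EF) (h : Ent X.ex (fun x => j (P x))) :
    IsDense j (incl hP) := by
  refine ⟨X, 𝟙 X, ⟨char hP, classifies_incl hP, ?_⟩, inferInstance⟩
  have : char hP ≫ j.hom = toOne X ≫ truth EF := by
    rw [char, LTTopology.hom, hom_comp, hom_eq_truth_iff]
    refine Ent.some P (ent_omega_ex.and (ent_omega_ex.and ?_))
    exact Ent.and (Ent.lam Ent.top) (Ent.lam ((Ent.refl _).fst.trans h))
  rw [this]
  exact classifies_id X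

/-- If `m` is classified by `C`, then the elements for which `C` is true lie in the image of `m`:
the subobject that they form factors through `m`. -/
theorem Classifies.ent_image {S : EFT EF} {C : FunPred X (omega EF)} {M : FunPred S X}
    (h : Classifies C.hom M.hom) :
    Ent (fun x => X.ex x ⊓ₑ C.pred x EF.top)
      (fun x => EvidencedFrame.some fun s => S.ex s ⊓ₑ M.pred s x) := by
  have hT : IsStable X (fun x => C.pred x EF.top) :=
    C.ent_ext (Ent.refl _).fst ent_omega_ex (Ent.refl _).snd
  have w : incl hT ≫ C.hom = toOne _ ≫ truth EF := by
    rw [incl, hom_comp, hom_eq_truth_iff]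
    exact Ent.some (fun x => x) ((Ent.refl _).fst.and (Ent.refl _))
  obtain ⟨l, hl⟩ : ∃ l, l ≫ M.hom = incl hT := ⟨_, h.lift_fst _ _ w⟩
  obtain ⟨L, rfl⟩ := exists_hom_eq l
  rw [incl, hom_comp, hom_eq_iff] at hl
  have r := Ent.refl (EF := EF) (fun x : X.carrier => X.ex x ⊓ₑ C.pred x EF.top)
  refine (hl.symm.ent (x := fun x : X.carrier => x) (y := fun x => x) r r.fst r.fst).elim ?_
  have r := Ent.refl (EF := EF) (fun p : X.carrier × S.carrier =>
    (X.ex p.1 ⊓ₑ C.pred p.1 EF.top) ⊓ₑ S.ex p.2 ⊓ₑ L.pred p.1 p.2 ⊓ₑ M.pred p.2 p.1)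
  exact Ent.some Prod.snd (r.snd.fst.and r.snd.snd.snd)

/-- If `m` is `j`-dense, then `j` forces every element of its codomain to lie in its image. -/
theorem IsDense.ent_image {j : LTTopology EF} {S : EFT EF} {M : FunPred S X}
    (h : IsDense j M.hom) :
    Ent X.ex (fun x => j (EvidencedFrame.some fun s => S.ex s ⊓ₑ M.pred s x)) := by
  obtain ⟨_, m, ⟨χ, hχ, hm⟩, _⟩ := h
  obtain ⟨C, rfl⟩ := exists_hom_eq χ
  have htrue : C.hom ≫ j.hom = toOne X ≫ truth EF := by
    rw [← cancel_epi m, hm.w, ← Category.assoc, toOne_unique (m ≫ toOne X)]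
  rw [LTTopology.hom, hom_comp, hom_eq_truth_iff] at htrue
  refine htrue.elim ?_
  have r := Ent.refl (EF := EF) (fun p : X.carrier × EF.Prp =>
    X.ex p.1 ⊓ₑ (omega EF).ex p.2 ⊓ₑ C.pred p.1 p.2 ⊓ₑ (j p.2 ⇔ₑ EF.top))
  refine j.ent_map (φ := Prod.snd) (Ent.ap r.snd.snd.snd.snd Ent.top) ?_
  have r := Ent.refl (EF := EF) (fun p : X.carrier × EF.Prp =>
    (X.ex p.1 ⊓ₑ (omega EF).ex p.2 ⊓ₑ C.pred p.1 p.2 ⊓ₑ (j p.2 ⇔ₑ EF.top)) ⊓ₑ p.2)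
  have hφ : Ent _ (fun p : X.carrier × EF.Prp => (omega EF).eqv p.2 EF.top) :=
    Ent.and (Ent.lam Ent.top) (Ent.lam ((Ent.refl _).fst.trans r.snd))
  exact (r.fst.fst.and (C.ent_ext r.fst.fst hφ r.fst.snd.snd.fst)).trans
    (hχ.ent_image.reindex Prod.fst)

/-! ### Separated objects -/

variable {j : LTTopology EF} {A : EFT EF}

theorem evidenceable_sep : Evidenceable (sep j A) ↔
    Ent (fun p : A.carrier × A.carrier =>
      (A.ex p.1 ⊓ₑ A.ex p.2) ⊓ₑ j (A.eqv p.1 p.2)) (fun p => A.eqv p.1 p.2) := by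
  rw [sep, evidenceable_all, ent_all, ent_imp]

/-- The binary product of `A` with itself. -/
def square (A : EFT EF) : EFT EF where
  carrier := A.carrier × A.carrier
  eqv p q := A.eqv p.1 q.1 ⊓ₑ A.eqv p.2 q.2
  sym := by
    rw [evidenceable_all, ent_all, ent_imp]
    exact (ent_symm (Ent.refl _).fst).and (ent_symm (Ent.refl _).snd)
  trs := by
    rw [evidenceable_all, ent_all, ent_all, ent_imp]
    exact (ent_trans (Ent.refl _).fst.fst (Ent.refl _).snd.fst).and
      (ent_trans (Ent.refl _).fst.snd (Ent.refl _).snd.snd)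

theorem isStable_eqv (A : EFT EF) : IsStable (square A) (fun p => A.eqv p.1 p.2) :=
  ent_trans (ent_symm (Ent.refl _).fst.fst) (ent_trans (Ent.refl _).snd (Ent.refl _).fst.snd)

theorem IsStable.map (j : LTTopology EF) (hP : IsStable X P) : IsStable X (fun x => j (P x)) :=
  j.ent_map (Ent.refl _).snd (hP.ent (Ent.refl _).fst.fst (Ent.refl _).snd)

/-- Separatedness of `A` is tested on the inclusion of the diagonal of `A × A` into its closure
`{(a, b) | j (a ∼ b)}`, on which the two projections to `A` agree. -/
theorem IsSeparated.evidenceable_sep (h : IsSeparated j A) : Evidenceable (sep j A) := by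
  rw [EFT.evidenceable_sep]
  let closure := sub (square A) _ ((isStable_eqv A).map j)
  have hD : IsStable closure (fun p => A.eqv p.1 p.2) :=
    (isStable_eqv A).ent (Ent.refl _).fst.fst (Ent.refl _).snd
  have hfst : IsExtensional closure A Prod.fst := isExtensional_iff.2 (Ent.refl _).fst.fst
  have hsnd : IsExtensional closure A Prod.snd := isExtensional_iff.2 (Ent.refl _).fst.snd
  have heq : (lift _ hfst).hom = (lift _ hsnd).hom := by
    refine h (incl hD) inferInstance (isDense_incl hD j (Ent.refl _).snd) ?_
    change incl hD ≫ _ = incl hD ≫ _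
    rw [incl, hom_comp, hom_comp, hom_eq_iff]
    refine FunPred.equiv_of_le ?_
    have r := Ent.refl (EF := EF) (fun q : (A.carrier × A.carrier) × A.carrier =>
      ((sub closure _ hD).ex q.1 ⊓ₑ A.ex q.2) ⊓ₑ
        ((inclPred hD).comp (lift _ hfst)).pred q.1 q.2)
    refine r.snd.elim (Ent.some Prod.snd ?_)
    have r := Ent.refl (EF := EF)
      (fun q : ((A.carrier × A.carrier) × A.carrier) × (A.carrier × A.carrier) =>
      (((sub closure _ hD).ex q.1.1 ⊓ₑ A.ex q.1.2) ⊓ₑ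
        ((inclPred hD).comp (lift _ hfst)).pred q.1.1 q.1.2) ⊓ₑ
        closure.ex q.2 ⊓ₑ closure.eqv q.1.1 q.2 ⊓ₑ A.eqv q.2.1 q.1.2)
    have hdiag : Ent _ (fun q : ((A.carrier × A.carrier) × A.carrier) × (A.carrier × A.carrier) =>
        A.eqv q.2.1 q.2.2) := hD.ent r.snd.snd.fst r.fst.fst.fst.snd
    exact r.snd.fst.and (r.snd.snd.fst.and (ent_trans (ent_symm hdiag) r.snd.snd.snd))
  have r := Ent.refl (EF := EF) (fun p : A.carrier × A.carrier =>
    (A.ex p.1 ⊓ₑ A.ex p.2) ⊓ₑ j (A.eqv p.1 p.2))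
  exact ent_symm (FunPred.Equiv.ent (hom_eq_iff.1 heq) (x := fun p => p) (y := Prod.fst)
    r r.fst.fst r.fst.fst)

theorem isSeparated_of_evidenceable_sep (h : Evidenceable (sep j A)) : IsSeparated j A := by
  intro S X m _ hm f g hfg
  obtain ⟨M, rfl⟩ := exists_hom_eq m
  obtain ⟨F, rfl⟩ := exists_hom_eq f
  obtain ⟨G, rfl⟩ := exists_hom_eq g
  change M.hom ≫ F.hom = M.hom ≫ G.hom at hfg
  rw [hom_comp, hom_comp, hom_eq_iff] at hfg
  refine hom_eq_iff.2 (FunPred.equiv_of_le ?_)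
  have r := Ent.refl (EF := EF) (fun p : X.carrier × A.carrier =>
    (X.ex p.1 ⊓ₑ A.ex p.2) ⊓ₑ F.pred p.1 p.2)
  refine (G.ent_tot r.fst.fst).elim ?_
  let Γ : (X.carrier × A.carrier) × A.carrier → EF.Prp := fun q =>
    ((X.ex q.1.1 ⊓ₑ A.ex q.1.2) ⊓ₑ F.pred q.1.1 q.1.2) ⊓ₑ A.ex q.2 ⊓ₑ G.pred q.1.1 q.2
  have r := Ent.refl Γ
  suffices hj : Ent Γ (fun q => j (A.eqv q.2 q.1.2)) from
    G.ent_ext r.fst.fst.fst (((r.snd.fst.and r.fst.fst.snd).and hj).trans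
      ((EFT.evidenceable_sep.1 h).reindex fun q : (X.carrier × A.carrier) × A.carrier =>
        (q.2, q.1.2))) r.snd.snd
  refine j.ent_map (r.fst.fst.fst.trans
    (hm.ent_image.reindex fun q : (X.carrier × A.carrier) × A.carrier => q.1.1)) ?_
  refine (Ent.refl _).snd.elim ?_
  have r := Ent.refl (EF := EF) (fun q : ((X.carrier × A.carrier) × A.carrier) × S.carrier =>
    (Γ q.1 ⊓ₑ EvidencedFrame.some fun s => S.ex s ⊓ₑ M.pred s q.1.1.1) ⊓ₑ
      S.ex q.2 ⊓ₑ M.pred q.2 q.1.1.1)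
  have rΓ := r.fst.fst
  exact G.ent_sv rΓ.fst.fst.fst rΓ.snd.fst rΓ.fst.fst.snd rΓ.snd.snd
    (FunPred.ent_of_comp r.snd.fst rΓ.fst.fst.fst rΓ.fst.fst.snd r.snd.snd
      (hfg.ent r.snd.fst rΓ.fst.fst.snd (FunPred.ent_comp rΓ.fst.fst.fst r.snd.snd rΓ.fst.snd)))

/-! ### Sheaves -/

theorem evidenceable_dsc {S : EFT EF} {M : FunPred S X} {G : FunPred S A} :
    Evidenceable (dsc j M G) ↔ Ent X.ex (fun x => EvidencedFrame.some fun a : A.carrier =>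
      A.ex a ⊓ₑ all fun b : A.carrier =>
        A.ex b ⊃ₑ (singleton j M G x b ⇔ₑ j (A.eqv a b))) := by
  rw [dsc, evidenceable_all, ent_imp]

/-- The value at `x` of an extension `F` of `G` along a dense `M` describes the `j`-singleton
of `x`. -/
theorem evidenceable_dsc_of_comp_eq {S : EFT EF} {M : FunPred S X} {G : FunPred S A}
    {F : FunPred X A} (hM : IsDense j M.hom) (hF : M.hom ≫ F.hom = G.hom) :
    Evidenceable (dsc j M G) := by
  rw [hom_comp, hom_eq_iff] at hF
  rw [evidenceable_dsc]
  refine (F.ent_tot (Ent.refl _)).elim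
    (Ent.some Prod.snd ((Ent.refl _).snd.fst.and (Ent.all (Ent.lam ?_))))
  let Γ : (X.carrier × A.carrier) × A.carrier → EF.Prp := fun p =>
    (X.ex p.1.1 ⊓ₑ A.ex p.1.2 ⊓ₑ F.pred p.1.1 p.1.2) ⊓ₑ A.ex p.2
  refine Ent.and (Γ := Γ) (Ent.lam ?_) (Ent.lam ?_)
  · refine j.ent_map (Ent.refl _).snd ((Ent.refl _).snd.elim ?_)
    have r := Ent.refl (EF := EF)
      (fun q : ((X.carrier × A.carrier) × A.carrier) × S.carrier =>
      ((Γ q.1 ⊓ₑ singleton j M G q.1.1.1 q.1.2) ⊓ₑ EvidencedFrame.some fun s : S.carrier =>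
        S.ex s ⊓ₑ M.pred s q.1.1.1 ⊓ₑ G.pred s q.1.2) ⊓ₑ
        S.ex q.2 ⊓ₑ M.pred q.2 q.1.1.1 ⊓ₑ G.pred q.2 q.1.2)
    have rΓ := r.fst.fst.fst
    exact F.ent_sv rΓ.fst.fst rΓ.fst.snd.fst rΓ.snd rΓ.fst.snd.snd
      (FunPred.ent_of_comp r.snd.fst rΓ.fst.fst rΓ.snd r.snd.snd.fst
        (hF.symm.ent r.snd.fst rΓ.snd r.snd.snd.snd))
  · -- Both the image of `M` and the equality `a ∼ b` are available under `j`.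
    refine j.ent_bind (Ent.refl _).snd (j.ent_map ((Ent.refl _).fst.fst.fst.fst.trans
      (hM.ent_image.reindex fun q : (X.carrier × A.carrier) × A.carrier => q.1.1))
      ((Ent.refl _).snd.elim (Ent.some Prod.snd ?_)))
    have r := Ent.refl (EF := EF)
      (fun q : ((X.carrier × A.carrier) × A.carrier) × S.carrier =>
      (((Γ q.1 ⊓ₑ j (A.eqv q.1.1.2 q.1.2)) ⊓ₑ A.eqv q.1.1.2 q.1.2) ⊓ₑ
        EvidencedFrame.some fun s : S.carrier => S.ex s ⊓ₑ M.pred s q.1.1.1) ⊓ₑ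
        S.ex q.2 ⊓ₑ M.pred q.2 q.1.1.1)
    have rΓ := r.fst.fst.fst.fst
    exact r.snd.fst.and (r.snd.snd.and (hF.ent r.snd.fst rΓ.snd
      (FunPred.ent_comp rΓ.fst.fst r.snd.snd
        (F.ent_ext rΓ.fst.fst r.fst.fst.snd rΓ.fst.snd.snd))))

/-- The functional predicate that relates `x` to the elements of its `j`-singleton. It is
single-valued since `A` is separated and total since the `j`-singletons are described by
elements of `A`. -/
def singletonPred (hsep : Evidenceable (sep j A)) {S : EFT EF} {M : FunPred S X}
    {G : FunPred S A} (hdsc : Evidenceable (dsc j M G)) : FunPred X A where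
  pred := singleton j M G
  ext := by
    rw [evidenceable_all, ent_all, ent_all, ent_all, ent_imp]
    refine j.ent_map (Ent.refl _).snd.snd ((Ent.refl _).snd.elim (Ent.some Prod.snd ?_))
    have r := Ent.refl (EF := EF)
      (fun p : (((X.carrier × X.carrier) × A.carrier) × A.carrier) × S.carrier =>
      ((X.eqv p.1.1.1.1 p.1.1.1.2 ⊓ₑ A.eqv p.1.1.2 p.1.2 ⊓ₑ
        singleton j M G p.1.1.1.1 p.1.1.2) ⊓ₑ
        EvidencedFrame.some fun s : S.carrier =>
          S.ex s ⊓ₑ M.pred s p.1.1.1.1 ⊓ₑ G.pred s p.1.1.2) ⊓ₑ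
        S.ex p.2 ⊓ₑ M.pred p.2 p.1.1.1.1 ⊓ₑ G.pred p.2 p.1.1.2)
    exact r.snd.fst.and ((M.ent_ext r.snd.fst r.fst.fst.fst r.snd.snd.fst).and
      (G.ent_ext r.snd.fst r.fst.fst.snd.fst r.snd.snd.snd))
  sv := by
    rw [evidenceable_all, ent_all, ent_all, ent_imp]
    refine ((Ent.refl _).fst.fst.trans ((evidenceable_dsc.1 hdsc).reindex
      fun p : (X.carrier × A.carrier) × A.carrier => p.1.1)).elim ?_
    let Γ : ((X.carrier × A.carrier) × A.carrier) × A.carrier → EF.Prp := fun p =>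
      ((X.ex p.1.1.1 ⊓ₑ A.ex p.1.1.2 ⊓ₑ A.ex p.1.2) ⊓ₑ
        singleton j M G p.1.1.1 p.1.1.2 ⊓ₑ singleton j M G p.1.1.1 p.1.2) ⊓ₑ
      A.ex p.2 ⊓ₑ all fun b : A.carrier =>
        A.ex b ⊃ₑ (singleton j M G p.1.1.1 b ⇔ₑ j (A.eqv p.2 b))
    have r := Ent.refl Γ
    have h1 : Ent Γ (fun p => j (A.eqv p.2 p.1.1.2)) :=
      ((r.snd.snd.inst (fun p => p.1.1.2)).ap r.fst.fst.snd.fst).fst.ap r.fst.snd.fst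
    have h2 : Ent Γ (fun p => j (A.eqv p.2 p.1.2)) :=
      ((r.snd.snd.inst (fun p => p.1.2)).ap r.fst.fst.snd.snd).fst.ap r.fst.snd.snd
    have h : Ent Γ (fun p => j (A.eqv p.1.1.2 p.1.2)) :=
      j.ent_bind h1 (j.ent_map ((Ent.refl _).fst.trans h2)
        (ent_trans (ent_symm (Ent.refl _).fst.snd) (Ent.refl _).snd))
    exact (r.fst.fst.snd.and h).trans ((evidenceable_sep.1 hsep).reindex
      fun p : ((X.carrier × A.carrier) × A.carrier) × A.carrier => (p.1.1.2, p.1.2))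
  tot := by
    rw [evidenceable_all, ent_imp]
    refine (evidenceable_dsc.1 hdsc).elim (Ent.some Prod.snd ((Ent.refl _).snd.fst.and ?_))
    have r := Ent.refl (EF := EF) (fun p : X.carrier × A.carrier => X.ex p.1 ⊓ₑ A.ex p.2 ⊓ₑ
      all fun b : A.carrier => A.ex b ⊃ₑ (singleton j M G p.1 b ⇔ₑ j (A.eqv p.2 b)))
    exact ((r.snd.snd.inst Prod.snd).ap r.snd.fst).snd.ap (j.ent_unit r.snd.fst)

theorem comp_singletonPred (hsep : Evidenceable (sep j A)) {S : EFT EF} {M : FunPred S X}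
    {G : FunPred S A} (hdsc : Evidenceable (dsc j M G)) :
    M.hom ≫ (singletonPred hsep hdsc).hom = G.hom := by
  refine (hom_eq_iff.2 (FunPred.equiv_of_le ?_)).symm
  have r := Ent.refl (EF := EF) (fun p : S.carrier × A.carrier =>
    (S.ex p.1 ⊓ₑ A.ex p.2) ⊓ₑ G.pred p.1 p.2)
  refine (M.ent_tot r.fst.fst).elim ?_
  have r := Ent.refl (EF := EF) (fun p : (S.carrier × A.carrier) × X.carrier =>
    ((S.ex p.1.1 ⊓ₑ A.ex p.1.2) ⊓ₑ G.pred p.1.1 p.1.2) ⊓ₑ X.ex p.2 ⊓ₑ M.pred p.1.1 p.2)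
  exact FunPred.ent_comp (y := Prod.snd) r.snd.fst r.snd.snd
    (j.ent_unit (Ent.some (fun p => p.1.1) (r.fst.fst.fst.and (r.snd.snd.and r.fst.snd))))

theorem isSeparated_iff : IsSeparated j A ↔ Evidenceable (sep j A) :=
  ⟨IsSeparated.evidenceable_sep, isSeparated_of_evidenceable_sep⟩

theorem isSheaf_iff : IsSheaf j A ↔ IsSeparated j A ∧
    ∀ (S X : EFT EF) (m : S ⟶ X), Mono m → IsDense j m → ∀ g : S ⟶ A,
      ∀ (M : FunPred S X) (G : FunPred S A), M.hom = m → G.hom = g →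
        Evidenceable (dsc j M G) := by
  constructor
  · intro h
    refine ⟨fun S X m hm hd => (h m hm hd).injective, ?_⟩
    rintro S X _ hm hd _ M G rfl rfl
    obtain ⟨f, hf⟩ := (h M.hom hm hd).surjective G.hom
    obtain ⟨F, rfl⟩ := exists_hom_eq f
    exact evidenceable_dsc_of_comp_eq hd hf
  · rintro ⟨hsep, hdsc⟩ S X m hm hd
    refine ⟨hsep m hm hd, fun g => ?_⟩
    obtain ⟨M, rfl⟩ := exists_hom_eq m
    obtain ⟨G, rfl⟩ := exists_hom_eq g
    exact ⟨_, comp_singletonPred hsep.evidenceable_sep (hdsc S X _ hm hd _ M G rfl rfl)⟩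

end EFT

theorem theorem4 (j : EFT.LTTopology kleeneEF) (A : EFT kleeneEF) :
    (EFT.IsSeparated j A ↔ EvidencedFrame.Evidenceable (EFT.sep j A)) ∧
    (EFT.IsSheaf j A ↔
      EFT.IsSeparated j A ∧
        ∀ (S X : EFT kleeneEF) (m : S ⟶ X), Mono m → EFT.IsDense j m → ∀ g : S ⟶ A,
          ∀ (M : EFT.FunPred S X) (G : EFT.FunPred S A), M.hom = m → G.hom = g →
            EvidencedFrame.Evidenceable (EFT.dsc j M G)) :=
  ⟨EFT.isSeparated_iff, EFT.isSheaf_iff⟩
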